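/- **Setting.** Let $d,N,m\ge 1$. On $\ell^2(\mathbb Z^d)\otimes\mathbb C^N$ (with $N=1$ the scalar lattice model) let $(\Delta f)(x)=\sum_{|y-x|_1=1}f(y)$ be the discrete Laplacian, and let $A$ be a nonsingular self-adjoint $N\times N$ matrix with $\|A\|\le 1$ (for instance $A=I$). Let $(U_if)(k)=f(k+i)$, let $\mathcal J$ be a subgroup (sublattice) of $\mathbb Z^d$, and let $P_0$ be an orthogonal projection of finite rank $m$ that is finitely supported, i.e. $P_0(\delta_x\otimes v)\ne 0$ for some $v\in\mathbb C^N$ only for finitely many sites $x$. Put $P_i=U_iP_0U_i^{-1}$ and assume $\sum_{i\in\mathcal J}P_i=I$ strongly. Let $(\omega_i)_{i\in\mathcal J}$ be independent, identically distributed real random variables on a probability space $(\Omega,\mathbb P)$ whose common law has a bounded density of compact support, and let $$H^\omega=\Delta\otimes A+\sum_{i\in\mathcal J}\omega_iP_i .$$ For an integer $\ell\ge 0$ let $\Lambda_\ell=\{x\in\mathbb Z^d:|x_j|\le \ell,\ 1\le j\le d\}$ and let $H_{\omega,\ell}=\chi_{\Lambda_\ell}H^\omega\chi_{\Lambda_\ell}$,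 a Hermitian matrix on $\ell^2(\Lambda_\ell)\otimes\mathbb C^N$. For a Borel set $B\subset\mathbb R$ let $E_{H_{\omega,\ell}}(B)$ be its spectral projection, so that $\mathrm{Tr}\,E_{H_{\omega,\ell}}(B)$ is the number of eigenvalues of $H_{\omega,\ell}$ in $B$, counted with multiplicity. **Proposition 1.2 (decorrelation estimate).** Let $\alpha,\beta$ be real numbers with $$0<\beta<\tfrac12,\qquad 0<\alpha+4\beta<1,\qquad 0<\alpha<\tfrac25\beta .$$ Let $E,E'\in\mathbb R$ be energies with $|E-E'|>4d$ (in particular, any two such energies in the region of complete localization $\Sigma_{\rm CL}$), and let $I,J\subset\mathbb R$ be bounded intervals. For an integer $L\ge1$ put $\ell=[L^\alpha]$ (integer part), $I_L(E)=L^{-d}I+E$ and $J_L(E')=L^{-d}J+E'$. Then there is a constant $C_0$, independent of $L$, such that for every integer $L\ge 1$ $$\mathbb P\Big\{\mathrm{Tr}\,E_{H_{\omega,\ell}}(I_L(E))\ge 1\ \text{ and }\ \mathrm{Tr}\,E_{H_{\omega,\ell}}(J_L(E'))\ge 1\Big\}\le\frac{C_0}{L^{2d(1-2\beta-\alpha)}}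 .$$ -/

import Mathlib

open MeasureTheory ProbabilityTheory

noncomputable section

namespace GenAnderson

/-- The space `ℓ²(ℤ^d) ⊗ ℂ^N`, realised as the square summable functions `ℤ^d → ℂ^N`.
The scalar lattice `ℓ²(ℤ^d)` is the case `N = 1`. -/
abbrev Hilb (d N : ℕ) : Type :=
  lp (fun _ : Fin d → ℤ => EuclideanSpace ℂ (Fin N)) 2

/-- The translation `(U_i f)(k) = f (k + i)`. -/
def shift {d N : ℕ} (i : Fin d → ℤ) : Hilb d N →ₗ[ℂ] Hilb d N where
  toFun f := ⟨fun k => f (k + i), by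
    have h0 : 0 < (2 : ENNReal).toReal := by norm_num
    have h := (memℓp_gen_iff h0).1 (lp.memℓp f)
    exact (memℓp_gen_iff h0).2 (h.comp_injective (add_left_injective i))⟩
  map_add' _ _ := rfl
  map_smul' _ _ := rfl

/-- `I ⊗ A`: the operator `A` applied to the value at every site. -/
def fiberwise {d N : ℕ} (A : EuclideanSpace ℂ (Fin N) →L[ℂ] EuclideanSpace ℂ (Fin N)) :
    Hilb d N →ₗ[ℂ] Hilb d N where
  toFun f := ⟨fun k => A (f k), by
    have h0 : 0 < (2 : ENNReal).toReal := by norm_num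
    have h := ((memℓp_gen_iff h0).1 (lp.memℓp f)).mul_left (‖A‖ ^ (2 : ENNReal).toReal)
    refine (memℓp_gen_iff h0).2 (h.of_nonneg_of_le (fun _ => by positivity) fun k => ?_)
    rw [← Real.mul_rpow (norm_nonneg _) (norm_nonneg _)]
    exact Real.rpow_le_rpow (norm_nonneg _) (A.le_opNorm _) h0.le⟩
  map_add' f g := by
    apply lp.ext
    funext k
    exact map_add A (f k) (g k)
  map_smul' c f := by
    apply lp.ext
    funext k
    exact map_smul A c (f k)

/-- The discrete Laplacian `(Δ f)(x) = ∑_{|y - x|₁ = 1} f y`. -/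
def laplacian (d N : ℕ) : Hilb d N →ₗ[ℂ] Hilb d N :=
  ∑ j : Fin d, (shift (Pi.single j 1) + shift (-Pi.single j 1))

/-- The translated operator `P_i = U_i P₀ U_i⁻¹`. -/
def translatedProj {d N : ℕ} (P₀ : Hilb d N →L[ℂ] Hilb d N) (i : Fin d → ℤ) :
    Hilb d N →ₗ[ℂ] Hilb d N :=
  shift i ∘ₗ (P₀ : Hilb d N →ₗ[ℂ] Hilb d N) ∘ₗ shift (-i)

/-- The Hamiltonian `H^ω f = (Δ ⊗ A) f + ∑_{i ∈ 𝓙} ω_i P_i f`. -/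
def hamiltonian {d N : ℕ} (A : EuclideanSpace ℂ (Fin N) →L[ℂ] EuclideanSpace ℂ (Fin N))
    (𝓙 : AddSubgroup (Fin d → ℤ)) (P₀ : Hilb d N →L[ℂ] Hilb d N) (ω : 𝓙 → ℝ)
    (f : Hilb d N) : Hilb d N :=
  laplacian d N (fiberwise A f) + ∑' i : 𝓙, (ω i : ℂ) • translatedProj P₀ (i : Fin d → ℤ) f

/-- The cube `Λ_ℓ = {x ∈ ℤ^d : |x_j| ≤ ℓ for all j}`. -/
def box (d ℓ : ℕ) : Finset (Fin d → ℤ) :=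
  Fintype.piFinset fun _ => Finset.Icc (-(ℓ : ℤ)) (ℓ : ℤ)

/-- The matrix of the finite-volume operator `H_{ω,ℓ} = χ_{Λ_ℓ} H^ω χ_{Λ_ℓ}` on
`ℓ²(Λ_ℓ) ⊗ ℂ^N` in the canonical orthonormal basis `δ_x ⊗ e_a`. -/
def finiteVolume {d N : ℕ} (A : EuclideanSpace ℂ (Fin N) →L[ℂ] EuclideanSpace ℂ (Fin N))
    (𝓙 : AddSubgroup (Fin d → ℤ)) (P₀ : Hilb d N →L[ℂ] Hilb d N) (ω : 𝓙 → ℝ) (ℓ : ℕ) :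
    Matrix (box d ℓ × Fin N) (box d ℓ × Fin N) ℂ :=
  Matrix.of fun p q =>
    hamiltonian A 𝓙 P₀ ω (lp.single 2 (q.1 : Fin d → ℤ) (EuclideanSpace.single q.2 (1 : ℂ)))
      (p.1 : Fin d → ℤ) p.2

/-- The spectral projection `E_H(B) = 1_B(H)` of a Hermitian matrix `H`. -/
def spectralProjection {n : Type*} [Fintype n] [DecidableEq n] (H : Matrix n n ℂ) (B : Set ℝ) :
    Matrix n n ℂ :=
  cfc (B.indicator (fun _ => (1 : ℝ))) H

/-- `Tr E_H(B)`. -/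
def spectralCount {n : Type*} [Fintype n] [DecidableEq n] (H : Matrix n n ℂ) (B : Set ℝ) : ℝ :=
  (spectralProjection H B).trace.re

/-- The scaled interval `L^{-d} I + E`. -/
def scaledInterval (d L : ℕ) (I : Set ℝ) (E : ℝ) : Set ℝ :=
  (fun t : ℝ => t / (L : ℝ) ^ d + E) '' I

end GenAnderson

end

/-!
The eigenvalues near `E` and near `E'` of the finite-volume matrix are functions of the coupling
constants, and the estimate says that they move independently enough for the two windows to cost a
factor `η = O(L^{-d})` each, up to a power of the volume.

*Transversality.* The coefficient matrices of the coupling constants sum to the identity, so if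
`φ` and `ψ` are unit eigenvectors for energies close to `E` and `E'`, then
`E - E' ≈ ⟪φ, Δφ⟫ - ⟪ψ, Δψ⟫ + ∑ ω_i (⟪φ, Q_i φ⟫ - ⟪ψ, Q_i ψ⟫)`. The Laplacian terms contribute at
most `4d`, so the two gradients, which both have entries summing to one, stay apart in `ℓ¹`, and
some `2 × 2` minor of the pair is at least a constant over the square of the number of coupling
constants (`exists_isTransversal`).

*Counting.* Freeze all coupling constants but the two of that minor. This is a two-parameter
eigenvalue problem: with `B`, `C` the two coefficient matrices, solutions `(φ_j, ψ_j)` at distinct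
points of the plane are orthogonal for the form of `B ⊗ C - C ⊗ B`. If the energies are known only
up to `η`, then two solutions at distance `T` are orthogonal up to `4η / T`, while the diagonal
values are the Jacobians, which are bounded below. The matrix of the form on `T`-separated solutions
is therefore diagonally dominant, the tensors `φ_j ⊗ ψ_j` are linearly independent, and there are at
most `(dim)²` such points (`packingNumber_isTransversal_le`). Hence the transversal points are
covered by `(dim)²` balls of radius `T`, a set of measure `O(η²)` times powers of the volume; no
differentiability or simplicity of eigenvalues is involved.

*Summation.* Fubini in the other coupling constants and a sum over pairs give the probability bound
`O(η² |Λ_ℓ|¹²)` (`measure_hasEigenvalue_pair_le`), and `12 α ≤ 4 β + 2 α` turns it into the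
asserted power of `L`.
-/

namespace GenAnderson

open scoped InnerProductSpace ENNReal NNReal

/-! ### Two-parameter eigenvalue problems -/

section TwoParameter

variable {V : Type*} [NormedAddCommGroup V] [InnerProductSpace ℂ V]

/-- The Jacobian of the pair (eigenvalue at `φ`, eigenvalue at `ψ`) under the two perturbations
`B` and `C`, polarised in its second arguments: for product vectors `φ ⊗ ψ` and `φ' ⊗ ψ'` it is
the sesquilinear form of `B ⊗ C - C ⊗ B`. -/
noncomputable def jacobianForm (B C : V →L[ℂ] V) (φ ψ φ' ψ' : V) : ℂ :=
  ⟪φ, B φ'⟫_ℂ * ⟪ψ, C ψ'⟫_ℂ - ⟪φ, C φ'⟫_ℂ * ⟪ψ, B ψ'⟫_ℂ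

/-- Product vectors whose matrix under the form of `B ⊗ C - C ⊗ B` is strictly diagonally dominant
are linearly independent in `V ⊗ V`. -/
theorem card_le_sq_finrank_of_diagonally_dominant [FiniteDimensional ℂ V] {κ : Type*} [Fintype κ]
    [DecidableEq κ] (B C : V →L[ℂ] V) (φ ψ : κ → V)
    (h : ∀ i, ∑ j ∈ Finset.univ.erase i, ‖jacobianForm B C (φ i) (ψ i) (φ j) (ψ j)‖
      < ‖jacobianForm B C (φ i) (ψ i) (φ i) (ψ i)‖) :
    Fintype.card κ ≤ Module.finrank ℂ V ^ 2 := by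
  have hdet := det_ne_zero_of_sum_row_lt_diag
    (A := Matrix.of fun i j => jacobianForm B C (φ i) (ψ i) (φ j) (ψ j)) h
  have hli : LinearIndependent ℂ fun j => (φ j ⊗ₜ[ℂ] ψ j : TensorProduct ℂ V V) := by
    rw [Fintype.linearIndependent_iff]
    intro c hc
    refine congrFun (Matrix.eq_zero_of_mulVec_eq_zero hdet (v := c) ?_)
    funext i
    -- the `i`-th row of the matrix is a linear functional of `φ j ⊗ ψ j`
    let f (D : V →L[ℂ] V) (v : V) : V →ₗ[ℂ] ℂ := ((innerSL ℂ v).comp D : V →L[ℂ] ℂ)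
    let L : TensorProduct ℂ V V →ₗ[ℂ] ℂ :=
      LinearMap.mul' ℂ ℂ ∘ₗ (TensorProduct.map (f B (φ i)) (f C (ψ i))
        - TensorProduct.map (f C (φ i)) (f B (ψ i)))
    have hL : L (∑ j, c j • φ j ⊗ₜ[ℂ] ψ j) = 0 := by rw [hc, map_zero]
    rw [map_sum] at hL
    simp only [Matrix.mulVec, dotProduct, Matrix.of_apply, Pi.zero_apply]
    rw [← hL]
    refine Finset.sum_congr rfl fun j _ => ?_
    simp [L, f, jacobianForm]
    ring
  simpa [sq] using hli.fintype_card_le_finrank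

/-- Cramer's rule for a `2 × 2` system with coefficients in the unit disc. -/
theorem mul_norm_det_le {x y : ℝ} {b c b' c' ε ε' : ℂ} (h : x * b + y * c = ε)
    (h' : x * b' + y * c' = ε') (hb : ‖b‖ ≤ 1) (hc : ‖c‖ ≤ 1) (hb' : ‖b'‖ ≤ 1) (hc' : ‖c'‖ ≤ 1) :
    |x| * ‖b * c' - c * b'‖ ≤ ‖ε‖ + ‖ε'‖ ∧ |y| * ‖b * c' - c * b'‖ ≤ ‖ε‖ + ‖ε'‖ := by
  have key : ∀ {u v w z : ℂ}, ‖v‖ ≤ 1 → ‖z‖ ≤ 1 → ‖u * v - w * z‖ ≤ ‖u‖ + ‖w‖ := by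
    intro u v w z hv hz
    refine (norm_sub_le _ _).trans ?_
    rw [norm_mul, norm_mul]
    exact add_le_add (mul_le_of_le_one_right (norm_nonneg _) hv)
      (mul_le_of_le_one_right (norm_nonneg _) hz)
  constructor
  · have : (x : ℂ) * (b * c' - c * b') = ε * c' - ε' * c := by rw [← h, ← h']; ring
    rw [← Real.norm_eq_abs, ← Complex.norm_real, ← norm_mul, this]
    exact key hc' hc
  · have : (y : ℂ) * (b * c' - c * b') = ε' * b - ε * b' := by rw [← h, ← h']; ring
    rw [← Real.norm_eq_abs, ← Complex.norm_real, ← norm_mul, this, add_comm ‖ε‖]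
    exact key hb hb'

/-- `H` has an eigenvalue within `η` of `E` and one within `η` of `E'`, with eigenvectors at which
the Jacobian with respect to the perturbations `B` and `C` is at least `δ`. -/
def IsTransversal (H B C : V →L[ℂ] V) (E E' η δ : ℝ) : Prop :=
  ∃ φ ψ : V, ‖φ‖ = 1 ∧ ‖ψ‖ = 1 ∧ ∃ e ∈ Set.Icc (E - η) (E + η), ∃ e' ∈ Set.Icc (E' - η) (E' + η),
    H φ = (e : ℂ) • φ ∧ H ψ = (e' : ℂ) • ψ ∧ δ ≤ ‖jacobianForm B C φ ψ φ ψ‖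

/-- Two eigenvectors of the same affine family at different parameters: both sides compute the
difference of the two operators between `φ` and `φ'`. -/
theorem inner_perturbation_eq {A B C : V →L[ℂ] V} (hA : A.IsSymmetric) (hB : B.IsSymmetric)
    (hC : C.IsSymmetric) {x y x' y' e e' : ℝ} {φ φ' : V}
    (h : (A + (x : ℂ) • B + (y : ℂ) • C) φ = (e : ℂ) • φ)
    (h' : (A + (x' : ℂ) • B + (y' : ℂ) • C) φ' = (e' : ℂ) • φ') :
    ((x - x' : ℝ) : ℂ) * ⟪φ, B φ'⟫_ℂ + ((y - y' : ℝ) : ℂ) * ⟪φ, C φ'⟫_ℂ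
      = ((e - e' : ℝ) : ℂ) * ⟪φ, φ'⟫_ℂ := by
  have h1 := congrArg (fun v => ⟪v, φ'⟫_ℂ) h
  have h2 := congrArg (fun v => ⟪φ, v⟫_ℂ) h'
  have a1 : ⟪A φ, φ'⟫_ℂ = ⟪φ, A φ'⟫_ℂ := hA φ φ'
  have b1 : ⟪B φ, φ'⟫_ℂ = ⟪φ, B φ'⟫_ℂ := hB φ φ'
  have c1 : ⟪C φ, φ'⟫_ℂ = ⟪φ, C φ'⟫_ℂ := hC φ φ'
  simp only [add_apply, smul_apply, inner_add_left,
    inner_add_right, inner_smul_left, inner_smul_right, Complex.conj_ofReal, a1, b1, c1] at h1 h2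
  push_cast
  linear_combination h1 - h2

theorem norm_inner_apply_le_one {B : V →L[ℂ] V} (hB : ‖B‖ ≤ 1) {φ ψ : V} (hφ : ‖φ‖ = 1)
    (hψ : ‖ψ‖ = 1) : ‖⟪φ, B ψ⟫_ℂ‖ ≤ 1 := by
  refine (norm_inner_le_norm _ _).trans ?_
  rw [hφ, one_mul]
  exact (B.le_opNorm _).trans (by rw [hψ, mul_one]; exact hB)

theorem abs_sub_le_of_mem_Icc {E η e e' : ℝ} (h : e ∈ Set.Icc (E - η) (E + η))
    (h' : e' ∈ Set.Icc (E - η) (E + η)) : |e - e'| ≤ 2 * η := by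
  rw [abs_le]
  constructor <;> linarith [h.1, h.2, h'.1, h'.2]

/-- In the plane of two coupling constants, a set of `T`-separated transversal points has at most
`(dim V)²` elements. -/
theorem packingNumber_isTransversal_le [FiniteDimensional ℂ V] {ι : Type*} [Fintype ι]
    [DecidableEq ι] {r s : ι} (hrs : r ≠ s) (huniv : (Finset.univ : Finset ι) = {r, s})
    {A : V →L[ℂ] V} {Q : ι → V →L[ℂ] V} (hA : A.IsSymmetric) (hQ : ∀ i, (Q i).IsSymmetric)
    (hQ1 : ∀ i, ‖Q i‖ ≤ 1) {E E' η δ : ℝ} {T : ℝ≥0}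
    (hT : 0 < T) (hδ : (Module.finrank ℂ V : ℝ) ^ 2 * (4 * η / T) < δ) :
    Metric.packingNumber T
      {z : ι → ℝ | IsTransversal (A + ∑ i, (z i : ℂ) • Q i) (Q r) (Q s) E E' η δ}
      ≤ (Module.finrank ℂ V ^ 2 : ℕ) := by
  refine iSup_le fun D => iSup_le fun hD => iSup_le fun hsep => ?_
  -- a finite subset with one point too many suffices for the contradiction
  by_contra! hlt
  obtain ⟨t, htD, htc⟩ := Set.exists_subset_encard_eq (Order.add_one_le_of_lt hlt)
  have htfin : t.Finite := Set.finite_of_encard_eq_coe (k := Module.finrank ℂ V ^ 2 + 1)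
    (by rw [htc]; push_cast; rfl)
  have := htfin.fintype
  have hcard : Fintype.card t = Module.finrank ℂ V ^ 2 + 1 := by
    rw [Set.encard_eq_coe_toFinset_card, Set.toFinset_card] at htc
    exact_mod_cast htc
  classical
  have hmem : ∀ z : t, IsTransversal (A + ∑ i, (z.1 i : ℂ) • Q i) (Q r) (Q s) E E' η δ :=
    fun z => hD (htD z.2)
  choose φ ψ hφ hψ e he e' he' hHφ hHψ hJ using hmem
  have hsum : ∀ z : t, A + ∑ i, (z.1 i : ℂ) • Q i
      = A + (z.1 r : ℂ) • Q r + (z.1 s : ℂ) • Q s := fun z => by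
    rw [huniv, Finset.sum_pair hrs, add_assoc]
  simp only [hsum] at hHφ hHψ
  have hoff : ∀ z w : t, w ≠ z →
      ‖jacobianForm (Q r) (Q s) (φ z) (ψ z) (φ w) (ψ w)‖ ≤ 4 * η / T := by
    intro z w hwz
    have hd : (T : ℝ≥0∞) < edist z.1 w.1 :=
      hsep (htD z.2) (htD w.2) fun h => hwz (Subtype.ext h.symm)
    have hd' : (T : ℝ) < dist z.1 w.1 := by
      rw [edist_nndist] at hd
      exact_mod_cast hd
    have hex : ∃ i, (T : ℝ) < |z.1 i - w.1 i| := by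
      by_contra! hcon
      exact absurd hd' (not_lt.2 ((dist_pi_le_iff T.2).2 hcon))
    have hε : ∀ {F : ℝ} {a a' : ℝ} {u v : V}, a ∈ Set.Icc (F - η) (F + η) →
        a' ∈ Set.Icc (F - η) (F + η) → ‖u‖ = 1 → ‖v‖ = 1 →
        ‖((a - a' : ℝ) : ℂ) * ⟪u, v⟫_ℂ‖ ≤ 2 * η := by
      intro F a a' u v ha ha' hu hv
      have h1 := abs_sub_le_of_mem_Icc ha ha'
      rw [norm_mul, Complex.norm_real, Real.norm_eq_abs]
      have h2 : ‖⟪u, v⟫_ℂ‖ ≤ 1 := (norm_inner_le_norm _ _).trans (by rw [hu, hv, one_mul])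
      exact (mul_le_of_le_one_right (abs_nonneg _) h2).trans h1
    have hkey := mul_norm_det_le
      (inner_perturbation_eq hA (hQ r) (hQ s) (hHφ z) (hHφ w))
      (inner_perturbation_eq hA (hQ r) (hQ s) (hHψ z) (hHψ w))
      (norm_inner_apply_le_one (hQ1 r) (hφ z) (hφ w))
      (norm_inner_apply_le_one (hQ1 s) (hφ z) (hφ w))
      (norm_inner_apply_le_one (hQ1 r) (hψ z) (hψ w))
      (norm_inner_apply_le_one (hQ1 s) (hψ z) (hψ w))
    have hε1 := hε (he z) (he w) (hφ z) (hφ w)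
    have hε2 := hε (he' z) (he' w) (hψ z) (hψ w)
    have hT' : (0 : ℝ) < T := by exact_mod_cast hT
    obtain ⟨i, hi⟩ := hex
    have hfin : |z.1 i - w.1 i| * ‖jacobianForm (Q r) (Q s) (φ z) (ψ z) (φ w) (ψ w)‖ ≤ 4 * η := by
      have : i = r ∨ i = s := by simpa [huniv] using Finset.mem_univ i
      rcases this with rfl | rfl
      · refine hkey.1.trans ?_
        linarith
      · refine hkey.2.trans ?_
        linarith
    rw [le_div_iff₀ hT', mul_comm]
    exact (mul_le_mul_of_nonneg_right hi.le (norm_nonneg _)).trans hfin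
  have hle := card_le_sq_finrank_of_diagonally_dominant (Q r) (Q s) φ ψ fun z => by
    refine (Finset.sum_le_card_nsmul _ _ _ fun w hw =>
      hoff z w (Finset.ne_of_mem_erase hw)).trans_lt (lt_of_lt_of_le ?_ (hJ z))
    rw [Finset.card_erase_of_mem (Finset.mem_univ z), Finset.card_univ, hcard, Nat.add_sub_cancel,
      nsmul_eq_mul]
    push_cast
    exact hδ
  omega

/-- Closedness, by compactness of the sphere; it supplies the measurability needed for Fubini. -/
theorem isClosed_setOf_isTransversal [FiniteDimensional ℂ V] {X : Type*} [TopologicalSpace X]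
    {H : X → V →L[ℂ] V} (hH : Continuous H) (B C : V →L[ℂ] V) (E E' η δ : ℝ) :
    IsClosed {x | IsTransversal (H x) B C E E' η δ} := by
  have := FiniteDimensional.proper ℂ V
  let S : Set (X × (Metric.sphere (0 : V) 1 × Metric.sphere (0 : V) 1 ×
      Set.Icc (E - η) (E + η) × Set.Icc (E' - η) (E' + η))) :=
    {p | H p.1 p.2.1 = ((p.2.2.2.1 : ℝ) : ℂ) • (p.2.1 : V) ∧
    H p.1 p.2.2.1 = ((p.2.2.2.2 : ℝ) : ℂ) • (p.2.2.1 : V) ∧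
    δ ≤ ‖jacobianForm B C p.2.1 p.2.2.1 p.2.1 p.2.2.1‖}
  have hS : IsClosed S := by
    refine IsClosed.and (isClosed_eq ?_ ?_) (IsClosed.and (isClosed_eq ?_ ?_) (isClosed_le ?_ ?_))
    · fun_prop
    · fun_prop
    · fun_prop
    · fun_prop
    · fun_prop
    · unfold jacobianForm
      fun_prop
  convert isClosedMap_fst_of_compactSpace _ hS using 1
  ext x
  constructor
  · rintro ⟨φ, ψ, hφ, hψ, e, he, e', he', h1, h2, h3⟩
    exact ⟨(x, ⟨φ, by simpa using hφ⟩, ⟨ψ, by simpa using hψ⟩, ⟨e, he⟩, ⟨e', he'⟩),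
      ⟨h1, h2, h3⟩, rfl⟩
  · rintro ⟨⟨x', φ, ψ, e, e'⟩, ⟨h1, h2, h3⟩, rfl⟩
    exact ⟨φ, ψ, by simp, by simp, e, e.2, e', e'.2, h1, h2, h3⟩

end TwoParameter

/-! ### Measure of sets with few separated points -/

section Measure

/-- A set that has few separated points has small measure, by covering it with balls. -/
theorem measure_le_packingNumber_mul {X : Type*} [PseudoMetricSpace X] [MeasurableSpace X]
    (ν : Measure X) {S : Set X} {T : ℝ≥0} {k : ℕ} {c : ℝ≥0∞} (hS : Metric.packingNumber T S ≤ k)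
    (hball : ∀ x, ν (Metric.closedBall x T) ≤ c) : ν S ≤ k * c := by
  have htop : Metric.packingNumber T S ≠ ⊤ := (hS.trans_lt (ENat.natCast_lt_top k)).ne
  have hcov := Metric.isCover_maximalSeparatedSet htop
  have henc := Metric.encard_maximalSeparatedSet htop
  set D := Metric.maximalSeparatedSet T S
  have hDfin : D.Finite := Set.encard_ne_top_iff.1 (by rw [henc]; exact htop)
  have hsub : S ⊆ ⋃ x ∈ hDfin.toFinset, Metric.closedBall x T := by
    intro y hy
    obtain ⟨x, hx, hxy⟩ := hcov hy
    refine Set.mem_biUnion (hDfin.mem_toFinset.2 hx) ?_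
    rw [← Metric.closedEBall_coe]
    exact hxy
  refine (measure_mono hsub).trans ((measure_biUnion_finset_le _ _).trans ?_)
  refine (Finset.sum_le_card_nsmul _ _ _ fun x _ => hball x).trans ?_
  rw [nsmul_eq_mul]
  gcongr
  rw [← henc, hDfin.encard_eq_coe_toFinset_card] at hS
  exact_mod_cast hS

theorem measure_pi_le_of_sections_le {F : Type*} [Fintype F] [DecidableEq F] (μ : Measure ℝ)
    [IsProbabilityMeasure μ] (s : Finset F) {S : Set (F → ℝ)} (hS : MeasurableSet S) {c : ℝ≥0∞}
    (h : ∀ x : F → ℝ, Measure.pi (fun _ : s => μ) {z | Function.updateFinset x s z ∈ S} ≤ c) :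
    Measure.pi (fun _ : F => μ) S ≤ c := by
  have key := lintegral_le_of_lmarginal_le (μ := fun _ : F => μ) s
    (f := S.indicator 1) (g := fun _ => c) (measurable_one.indicator hS) measurable_const ?_
  · simpa [lintegral_indicator_one hS] using key
  · intro x
    have hm : MeasurableSet {z : s → ℝ | Function.updateFinset x s z ∈ S} :=
      measurable_updateFinset hS
    have : (fun z : s → ℝ => S.indicator (1 : (F → ℝ) → ℝ≥0∞) (Function.updateFinset x s z))
        = {z : s → ℝ | Function.updateFinset x s z ∈ S}.indicator 1 := by
      ext z
      simp [Set.indicator]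
    simp only [lmarginal, this, lintegral_indicator_one hm, lintegral_const, measure_univ, mul_one]
    exact h x

end Measure

/-! ### Decorrelation for affine families of symmetric operators -/

section Decorrelation

variable {V : Type*} [NormedAddCommGroup V] [InnerProductSpace ℂ V] {F : Type*} [Fintype F]

/-- Summing the minors `u r * v s - u s * v r` over `s` gives `u r - v r`, so vectors that are far
apart in `ℓ¹` have a large minor. -/
theorem exists_le_abs_det_of_sum_eq_one {u v : F → ℝ} (hu : ∑ i, u i = 1) (hv : ∑ i, v i = 1)
    {c X : ℝ} (hX : 1 ≤ X) (hF : (Fintype.card F : ℝ) ≤ X) (hc : 0 < c)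
    (h : c < ∑ i, |u i - v i|) : ∃ r s, c / X ^ 2 ≤ |u r * v s - u s * v r| := by
  by_contra! hcon
  have h1 : ∀ r, |u r - v r| ≤ Fintype.card F * (c / X ^ 2) := by
    intro r
    have : u r - v r = ∑ s, (u r * v s - u s * v r) := by
      rw [Finset.sum_sub_distrib, ← Finset.mul_sum, ← Finset.sum_mul, hu, hv]
      ring
    rw [this]
    refine (Finset.abs_sum_le_sum_abs _ _).trans ?_
    refine (Finset.sum_le_card_nsmul _ _ _ fun s _ => (hcon r s).le).trans ?_
    rw [nsmul_eq_mul, Finset.card_univ]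
  have h2 := Finset.sum_le_card_nsmul Finset.univ _ _ fun r _ => h1 r
  rw [nsmul_eq_mul, Finset.card_univ] at h2
  have h3 : (Fintype.card F : ℝ) * (Fintype.card F * (c / X ^ 2)) ≤ X * (X * (c / X ^ 2)) := by
    gcongr
  have h4 : X * (X * (c / X ^ 2)) = c := by field_simp
  linarith

/-- If the energies differ by more than the form of the unperturbed operator allows, then the
gradients of the two eigenvalues cannot be nearly parallel: some pair of coupling constants has a
Jacobian bounded below by a power of the number of coupling constants. -/
theorem exists_isTransversal {K : V →L[ℂ] V} {Q : F → V →L[ℂ] V} (hQ : ∀ i, (Q i).IsSymmetric)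
    (hQsum : ∑ i, Q i = 1) {k : ℝ} (hk : ∀ v : V, ‖⟪v, K v⟫_ℂ‖ ≤ k * ‖v‖ ^ 2)
    {E E' η κ R X : ℝ} (hE : 2 * k + κ ≤ |E - E'|) (hκ : 0 < κ) (hη : 4 * η < κ) (hR : 0 < R)
    (hX : 1 ≤ X) (hF : (Fintype.card F : ℝ) ≤ X) {z : F → ℝ} (hz : ∀ i, |z i| ≤ R)
    {e e' : ℝ} (he : e ∈ Set.Icc (E - η) (E + η)) (he' : e' ∈ Set.Icc (E' - η) (E' + η))
    (hHe : Module.End.HasEigenvalue (K + ∑ i, (z i : ℂ) • Q i : V →L[ℂ] V).toLinearMap (e : ℂ))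
    (hHe' : Module.End.HasEigenvalue (K + ∑ i, (z i : ℂ) • Q i : V →L[ℂ] V).toLinearMap (e' : ℂ)) :
    ∃ r s, IsTransversal (K + ∑ i, (z i : ℂ) • Q i) (Q r) (Q s) E E' η
      (κ / (2 * R) / X ^ 2) := by
  have hunit : ∀ {a : ℝ}, Module.End.HasEigenvalue
      (K + ∑ i, (z i : ℂ) • Q i : V →L[ℂ] V).toLinearMap (a : ℂ) →
      ∃ φ : V, ‖φ‖ = 1 ∧ (K + ∑ i, (z i : ℂ) • Q i) φ = (a : ℂ) • φ := by
    intro a ha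
    obtain ⟨v, hv⟩ := ha.exists_hasEigenvector
    refine ⟨((‖v‖⁻¹ : ℝ) : ℂ) • v, ?_, ?_⟩
    · rw [norm_smul, Complex.norm_real, norm_inv, norm_norm,
        inv_mul_cancel₀ (norm_ne_zero_iff.2 hv.2)]
    · have h1 : (K + ∑ i, (z i : ℂ) • Q i) v = (a : ℂ) • v := hv.apply_eq_smul
      rw [map_smul, h1, smul_comm]
  obtain ⟨φ, hφ, hHφ⟩ := hunit hHe
  obtain ⟨ψ, hψ, hHψ⟩ := hunit hHe'
  have hreal : ∀ (v : V) (i : F), ⟪v, Q i v⟫_ℂ = ((⟪v, Q i v⟫_ℂ).re : ℂ) := fun v i => by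
    refine (Complex.conj_eq_iff_re.1 ?_).symm
    rw [inner_conj_symm]
    exact hQ i v v
  have hone : ∀ v : V, ‖v‖ = 1 → ∑ i, (⟪v, Q i v⟫_ℂ).re = 1 := fun v hv => by
    rw [← Complex.re_sum, ← inner_sum, ← sum_apply, hQsum]
    simp [hv, inner_self_eq_norm_sq_to_K]
  have hform : ∀ {v : V} {a : ℝ}, ‖v‖ = 1 → (K + ∑ i, (z i : ℂ) • Q i) v = (a : ℂ) • v →
      (⟪v, K v⟫_ℂ).re + ∑ i, z i * (⟪v, Q i v⟫_ℂ).re = a := by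
    intro v a hv h
    have h1 := congrArg (fun w => (⟪v, w⟫_ℂ).re) h
    simpa [inner_add_right, inner_sum, inner_smul_right, hv, inner_self_eq_norm_sq_to_K,
      sum_apply] using h1
  have hK : ∀ v : V, ‖v‖ = 1 → |(⟪v, K v⟫_ℂ).re| ≤ k := fun v hv =>
    (Complex.abs_re_le_norm _).trans ((hk v).trans (by rw [hv]; simp))
  have hsep : κ / (2 * R) < ∑ i, |(⟪φ, Q i φ⟫_ℂ).re - (⟪ψ, Q i ψ⟫_ℂ).re| := by
    have h1 : |∑ i, z i * ((⟪φ, Q i φ⟫_ℂ).re - (⟪ψ, Q i ψ⟫_ℂ).re)|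
        ≤ R * ∑ i, |(⟪φ, Q i φ⟫_ℂ).re - (⟪ψ, Q i ψ⟫_ℂ).re| := by
      rw [Finset.mul_sum]
      refine (Finset.abs_sum_le_sum_abs _ _).trans (Finset.sum_le_sum fun i _ => ?_)
      rw [abs_mul]
      gcongr
      exact hz i
    have h2 : ∑ i, z i * ((⟪φ, Q i φ⟫_ℂ).re - (⟪ψ, Q i ψ⟫_ℂ).re)
        = (e - e') - ((⟪φ, K φ⟫_ℂ).re - (⟪ψ, K ψ⟫_ℂ).re) := by
      rw [← hform hφ hHφ, ← hform hψ hHψ]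
      simp only [mul_sub, Finset.sum_sub_distrib]
      ring
    rw [h2] at h1
    rw [div_lt_iff₀ (by positivity)]
    have h3 := abs_le.1 (hK φ hφ)
    have h4 := abs_le.1 (hK ψ hψ)
    have h5 := abs_le.1 h1
    obtain h6 | h6 := le_abs.1 hE <;> linarith [he.1, he.2, he'.1, he'.2]
  obtain ⟨r, s, hrs⟩ := exists_le_abs_det_of_sum_eq_one (hone φ hφ) (hone ψ hψ) hX hF
    (by positivity) hsep
  refine ⟨r, s, φ, ψ, hφ, hψ, e, he, e', he', hHφ, hHψ, hrs.trans_eq ?_⟩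
  rw [jacobianForm, hreal φ r, hreal φ s, hreal ψ r, hreal ψ s]
  rw [← Complex.ofReal_mul, ← Complex.ofReal_mul, ← Complex.ofReal_sub, Complex.norm_real,
    Real.norm_eq_abs]
  simp only [Complex.ofReal_re]

theorem isSymmetric_add_sum_smul {ι : Type*} {K : V →L[ℂ] V} {Q : ι → V →L[ℂ] V}
    (hK : K.IsSymmetric) (hQ : ∀ i, (Q i).IsSymmetric) (z : ι → ℝ) (s : Finset ι) :
    (K + ∑ i ∈ s, (z i : ℂ) • Q i).IsSymmetric := by
  intro v w
  have h1 : ⟪K v, w⟫_ℂ = ⟪v, K w⟫_ℂ := hK v w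
  have h2 : ∀ i, ⟪Q i v, w⟫_ℂ = ⟪v, Q i w⟫_ℂ := fun i => hQ i v w
  simp [-Complex.coe_smul, inner_add_left, inner_add_right, sum_inner, inner_sum, inner_smul_left,
    inner_smul_right, h1, h2]

/-- With all coupling constants but two frozen, the transversal points fill little of the plane of
the two remaining ones. -/
theorem measure_isTransversal_le [FiniteDimensional ℂ V] {K : V →L[ℂ] V} {Q : F → V →L[ℂ] V}
    (hKsymm : K.IsSymmetric) (hQ : ∀ i, (Q i).IsSymmetric) (hQ1 : ∀ i, ‖Q i‖ ≤ 1)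
    (μ : Measure ℝ) [IsProbabilityMeasure μ] {M : ℝ}
    (hμ : ∀ x ρ : ℝ, 0 ≤ ρ → μ (Metric.closedBall x ρ) ≤ ENNReal.ofReal (2 * M * ρ))
    {E E' η δ : ℝ} (hδ : 0 < δ) {T : ℝ≥0} (hT : 0 < T)
    (hTδ : (Module.finrank ℂ V : ℝ) ^ 2 * (4 * η / T) < δ) (r s : F) :
    Measure.pi (fun _ : F => μ)
      {z | IsTransversal (K + ∑ i, (z i : ℂ) • Q i) (Q r) (Q s) E E' η δ}
      ≤ (Module.finrank ℂ V ^ 2 : ℕ) * ENNReal.ofReal (2 * M * T) ^ 2 := by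
  classical
  rcases eq_or_ne r s with rfl | hrs
  · -- the Jacobian vanishes identically when the two coupling constants coincide
    have : {z : F → ℝ | IsTransversal (K + ∑ i, (z i : ℂ) • Q i) (Q r) (Q r) E E' η δ} = ∅ := by
      refine Set.eq_empty_of_forall_notMem fun z => ?_
      rintro ⟨φ, ψ, -, -, e, -, e', -, -, -, h⟩
      simp only [jacobianForm, sub_self, norm_zero] at h
      linarith
    rw [this, measure_empty]
    exact zero_le
  have hcl : IsClosed
      {z : F → ℝ | IsTransversal (K + ∑ i, (z i : ℂ) • Q i) (Q r) (Q s) E E' η δ} :=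
    isClosed_setOf_isTransversal (by fun_prop) _ _ _ _ _ _
  refine measure_pi_le_of_sections_le μ {r, s} hcl.measurableSet fun x => ?_
  let p : Finset F := {r, s}
  let r' : p := ⟨r, by simp [p]⟩
  let s' : p := ⟨s, by simp [p]⟩
  have hsplit : ∀ z : p → ℝ, K + ∑ i, (Function.updateFinset x p z i : ℂ) • Q i
      = (K + ∑ i ∈ pᶜ, (x i : ℂ) • Q i) + ∑ i : p, (z i : ℂ) • Q i := by
    intro z
    rw [← Finset.sum_compl_add_sum p, ← add_assoc, ← Finset.sum_coe_sort p]
    congr 1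
    · congr 1
      refine Finset.sum_congr rfl fun i hi => ?_
      rw [Function.updateFinset, dif_neg (Finset.mem_compl.1 hi)]
    · refine Finset.sum_congr rfl fun i _ => ?_
      rw [Function.updateFinset, dif_pos i.2]
  have hpuniv : (Finset.univ : Finset p) = {r', s'} := by
    refine (Finset.eq_univ_of_forall fun ⟨i, hi⟩ => ?_).symm
    have h : i = r ∨ i = s := by simpa [p] using hi
    rcases h with rfl | rfl <;> simp [r', s']
  have hpack := packingNumber_isTransversal_le (r := r') (s := s')
    (fun h => hrs (congrArg Subtype.val h)) hpuniv
    (isSymmetric_add_sum_smul hKsymm hQ x pᶜ) (Q := fun i : p => Q i) (fun i => hQ i)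
    (fun i => hQ1 i) (E := E) (E' := E') hT hTδ
  change Measure.pi (fun _ : p => μ) {z | IsTransversal
    (K + ∑ i, (Function.updateFinset x p z i : ℂ) • Q i) (Q r) (Q s) E E' η δ} ≤ _
  simp only [hsplit]
  refine measure_le_packingNumber_mul _ hpack fun y => ?_
  rw [Measure.pi_closedBall _ _ T.coe_nonneg]
  refine (Finset.prod_le_prod' fun i _ => hμ (y i) T T.coe_nonneg).trans_eq ?_
  rw [Finset.prod_const, Finset.card_univ, Fintype.card_coe, Finset.card_pair hrs]

/-- The decorrelation estimate for an affine family `K + ∑ z i • Q i` with a resolution of the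
identity `Q` and independent couplings of common law `μ`, where the form of `K` varies by less than
the distance of the energies. The exponent `12` is `2` for the choice of a pair, `2` for the count
of separated points, and `8` for the square of the radius `T`. -/
theorem measure_hasEigenvalue_pair_le [FiniteDimensional ℂ V] {K : V →L[ℂ] V}
    {Q : F → V →L[ℂ] V} (hKsymm : K.IsSymmetric) (hQ : ∀ i, (Q i).IsSymmetric)
    (hQ1 : ∀ i, ‖Q i‖ ≤ 1) (hQsum : ∑ i, Q i = 1)
    {k : ℝ} (hk : ∀ v : V, ‖⟪v, K v⟫_ℂ‖ ≤ k * ‖v‖ ^ 2)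
    (μ : Measure ℝ) [IsProbabilityMeasure μ] {M R : ℝ} (hM : 0 ≤ M)
    (hμ : ∀ x ρ : ℝ, 0 ≤ ρ → μ (Metric.closedBall x ρ) ≤ ENNReal.ofReal (2 * M * ρ))
    (hR : 0 < R) (hμR : ∀ᵐ x ∂μ, |x| ≤ R)
    {E E' η κ X : ℝ} (hE : 2 * k + κ ≤ |E - E'|) (hκ : 0 < κ) (hη : 0 < η)
    (hX : 1 ≤ X) (hF : (Fintype.card F : ℝ) ≤ X) (hV : (Module.finrank ℂ V : ℝ) ≤ X) :
    Measure.pi (fun _ : F => μ)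
      {z | (∃ e ∈ Set.Icc (E - η) (E + η), Module.End.HasEigenvalue
          (K + ∑ i, (z i : ℂ) • Q i : V →L[ℂ] V).toLinearMap (e : ℂ)) ∧
        ∃ e' ∈ Set.Icc (E' - η) (E' + η), Module.End.HasEigenvalue
          (K + ∑ i, (z i : ℂ) • Q i : V →L[ℂ] V).toLinearMap (e' : ℂ)}
      ≤ ENNReal.ofReal ((16 + 400 * M ^ 2 * R ^ 2) / κ ^ 2 * X ^ 12 * η ^ 2) := by
  set W := {z : F → ℝ | (∃ e ∈ Set.Icc (E - η) (E + η), Module.End.HasEigenvalue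
          (K + ∑ i, (z i : ℂ) • Q i : V →L[ℂ] V).toLinearMap (e : ℂ)) ∧
        ∃ e' ∈ Set.Icc (E' - η) (E' + η), Module.End.HasEigenvalue
          (K + ∑ i, (z i : ℂ) • Q i : V →L[ℂ] V).toLinearMap (e' : ℂ)}
  rcases le_or_gt κ (4 * η) with hηκ | hηκ
  · -- for windows that are not short compared with the gap the bound exceeds one
    refine prob_le_one.trans ?_
    rw [ENNReal.one_le_ofReal]
    have h1 : κ ^ 2 ≤ 16 * η ^ 2 := by nlinarith
    have h2 : (1 : ℝ) ≤ X ^ 12 := one_le_pow₀ hX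
    have h3 : 1 ≤ 16 / κ ^ 2 * 1 * η ^ 2 := by
      rw [mul_one, div_mul_eq_mul_div, one_le_div (by positivity)]
      exact h1
    refine h3.trans ?_
    gcongr
    linarith [show 0 ≤ 400 * M ^ 2 * R ^ 2 by positivity]
  have hX0 : 0 < X := by linarith
  set δ := κ / (2 * R) / X ^ 2 with hδdef
  have hδ : 0 < δ := by positivity
  -- the least radius, up to a constant, at which the separated points are diagonally dominant
  let T : ℝ≥0 := ⟨5 * X ^ 2 * η / δ, by positivity⟩
  have hTval : (T : ℝ) = 5 * X ^ 2 * η / δ := rfl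
  have hT : 0 < T := by
    rw [← NNReal.coe_pos, hTval]
    positivity
  have hTδ : (Module.finrank ℂ V : ℝ) ^ 2 * (4 * η / T) < δ := by
    have h1 : (Module.finrank ℂ V : ℝ) ^ 2 * (4 * η / T) ≤ X ^ 2 * (4 * η / T) := by gcongr
    have h2 : X ^ 2 * (4 * η / T) = 4 / 5 * δ := by
      rw [hTval]
      field_simp
    linarith
  have hcover : W ⊆ {z : F → ℝ | ¬ ∀ i, |z i| ≤ R} ∪ ⋃ r, ⋃ s,
      {z | IsTransversal (K + ∑ i, (z i : ℂ) • Q i) (Q r) (Q s) E E' η δ} := by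
    rintro z ⟨⟨e, he, hHe⟩, e', he', hHe'⟩
    by_cases hz : ∀ i, |z i| ≤ R
    · obtain ⟨r, s, hrs⟩ := exists_isTransversal hQ hQsum hk hE hκ hηκ hR hX hF hz he he' hHe hHe'
      exact Or.inr (Set.mem_iUnion₂.2 ⟨r, s, hrs⟩)
    · exact Or.inl hz
  have hnull : Measure.pi (fun _ : F => μ) {z : F → ℝ | ¬ ∀ i, |z i| ≤ R} = 0 :=
    ae_all_iff.2 fun i => (Measure.tendsto_eval_ae_ae (μ := fun _ : F => μ) (i := i)).eventually hμR
  calc Measure.pi (fun _ : F => μ) W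
      ≤ ∑ r, ∑ s, Measure.pi (fun _ : F => μ)
          {z | IsTransversal (K + ∑ i, (z i : ℂ) • Q i) (Q r) (Q s) E E' η δ} := by
        refine (measure_mono hcover).trans ((measure_union_le _ _).trans ?_)
        rw [hnull, zero_add]
        refine (measure_iUnion_fintype_le _ _).trans (Finset.sum_le_sum fun r _ => ?_)
        exact measure_iUnion_fintype_le _ _
    _ ≤ ∑ _r : F, ∑ _s : F,
          ((Module.finrank ℂ V ^ 2 : ℕ) * ENNReal.ofReal (2 * M * T) ^ 2 : ℝ≥0∞) :=
        Finset.sum_le_sum fun r _ => Finset.sum_le_sum fun s _ =>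
          measure_isTransversal_le hKsymm hQ hQ1 μ hμ hδ hT hTδ r s
    _ = ENNReal.ofReal ((Fintype.card F : ℝ) * ((Fintype.card F : ℝ) *
          ((Module.finrank ℂ V : ℝ) ^ 2 * (2 * M * T) ^ 2))) := by
        rw [Finset.sum_const, Finset.sum_const, Finset.card_univ, nsmul_eq_mul, nsmul_eq_mul,
          ← ENNReal.ofReal_pow (by positivity), ← ENNReal.ofReal_natCast (Fintype.card F),
          ← ENNReal.ofReal_natCast (Module.finrank ℂ V ^ 2), ← ENNReal.ofReal_mul (by positivity),
          ← ENNReal.ofReal_mul (by positivity), ← ENNReal.ofReal_mul (by positivity), Nat.cast_pow]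
    _ ≤ _ := by
        refine ENNReal.ofReal_le_ofReal ?_
        calc (Fintype.card F : ℝ) * ((Fintype.card F : ℝ) *
              ((Module.finrank ℂ V : ℝ) ^ 2 * (2 * M * T) ^ 2))
            ≤ X * (X * (X ^ 2 * (2 * M * T) ^ 2)) := by gcongr
          _ = 400 * M ^ 2 * R ^ 2 / κ ^ 2 * X ^ 12 * η ^ 2 := by
              rw [hTval, hδdef]
              field_simp
              ring
          _ ≤ _ := by
              gcongr
              linarith

end Decorrelation

/-! ### Lattice operators -/

section Lattice

variable {d N : ℕ}

theorem shift_shift (i j : Fin d → ℤ) (f : Hilb d N) : shift i (shift j f) = shift (i + j) f := by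
  apply lp.ext
  funext k
  exact congrArg (fun x => f x) (add_assoc k i j)

theorem shift_zero (f : Hilb d N) : shift 0 f = f := by
  apply lp.ext
  funext k
  exact congrArg (fun x => f x) (add_zero k)

theorem inner_shift_left (i : Fin d → ℤ) (f g : Hilb d N) :
    ⟪shift i f, g⟫_ℂ = ⟪f, shift (-i) g⟫_ℂ := by
  rw [lp.inner_eq_tsum, lp.inner_eq_tsum,
    ← (Equiv.addRight i).tsum_eq fun k => ⟪f k, shift (-i) g k⟫_ℂ]
  refine tsum_congr fun k => ?_
  change ⟪f (k + i), g k⟫_ℂ = ⟪f (k + i), g (k + i + -i)⟫_ℂ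
  rw [add_neg_cancel_right]

theorem norm_shift (i : Fin d → ℤ) (f : Hilb d N) : ‖shift i f‖ = ‖f‖ := by
  have h : ⟪shift i f, shift i f⟫_ℂ = ⟪f, f⟫_ℂ := by
    rw [inner_shift_left, shift_shift, neg_add_cancel, shift_zero]
  rw [@norm_eq_sqrt_re_inner ℂ, h, ← @norm_eq_sqrt_re_inner ℂ]

theorem shift_single (i x : Fin d → ℤ) (v : EuclideanSpace ℂ (Fin N)) :
    shift i (lp.single 2 x v) = lp.single 2 (x - i) v := by
  apply lp.ext
  funext k
  change lp.single (E := fun _ : Fin d → ℤ => EuclideanSpace ℂ (Fin N)) 2 x v (k + i)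
    = lp.single (E := fun _ : Fin d → ℤ => EuclideanSpace ℂ (Fin N)) 2 (x - i) v k
  simp only [lp.single_apply, Pi.single_apply, eq_sub_iff_add_eq]

theorem norm_fiberwise_le (A : EuclideanSpace ℂ (Fin N) →L[ℂ] EuclideanSpace ℂ (Fin N))
    (f : Hilb d N) : ‖fiberwise A f‖ ≤ ‖A‖ * ‖f‖ := by
  have h : ‖fiberwise A f‖ ≤ ‖((‖A‖ : ℝ) : ℂ) • f‖ := by
    refine lp.norm_mono (by norm_num) fun k => ?_
    rw [lp.coeFn_smul, Pi.smul_apply, norm_smul, Complex.norm_real, norm_norm]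
    exact A.le_opNorm _
  rwa [norm_smul, Complex.norm_real, norm_norm] at h

theorem inner_laplacian_fiberwise_left {A : EuclideanSpace ℂ (Fin N) →L[ℂ] EuclideanSpace ℂ (Fin N)}
    (hA : IsSelfAdjoint A) (f g : Hilb d N) :
    ⟪laplacian d N (fiberwise A f), g⟫_ℂ = ⟪f, laplacian d N (fiberwise A g)⟫_ℂ := by
  have hfib : ∀ f g : Hilb d N, ⟪fiberwise A f, g⟫_ℂ = ⟪f, fiberwise A g⟫_ℂ := fun f g => by
    rw [lp.inner_eq_tsum, lp.inner_eq_tsum]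
    exact tsum_congr fun k => hA.isSymmetric (f k) (g k)
  have hcomm : ∀ (i : Fin d → ℤ) (f : Hilb d N),
      fiberwise A (shift i f) = shift i (fiberwise A f) := fun _ _ => rfl
  simp only [laplacian, LinearMap.sum_apply, LinearMap.add_apply, sum_inner, inner_sum,
    inner_add_left, inner_add_right, inner_shift_left, neg_neg, hfib, hcomm]
  exact Finset.sum_congr rfl fun j _ => add_comm _ _

theorem norm_laplacian_fiberwise_le {A : EuclideanSpace ℂ (Fin N) →L[ℂ] EuclideanSpace ℂ (Fin N)}
    (hA : ‖A‖ ≤ 1) (f : Hilb d N) : ‖laplacian d N (fiberwise A f)‖ ≤ 2 * d * ‖f‖ := by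
  have h1 : ‖fiberwise A f‖ ≤ ‖f‖ :=
    (norm_fiberwise_le A f).trans (mul_le_of_le_one_left (norm_nonneg f) hA)
  rw [laplacian, LinearMap.sum_apply]
  refine (norm_sum_le _ _).trans
    ((Finset.sum_le_card_nsmul _ _ (2 * ‖f‖) fun j _ => ?_).trans_eq ?_)
  · refine (norm_add_le _ _).trans ?_
    rw [norm_shift, norm_shift]
    linarith
  · rw [Finset.card_univ, Fintype.card_fin, nsmul_eq_mul]
    ring

variable {P₀ : Hilb d N →L[ℂ] Hilb d N}

theorem inner_translatedProj_left (hP₀ : IsStarProjection P₀) (i : Fin d → ℤ) (f g : Hilb d N) :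
    ⟪translatedProj P₀ i f, g⟫_ℂ = ⟪f, translatedProj P₀ i g⟫_ℂ := by
  have h := hP₀.isSelfAdjoint.isSymmetric (shift (-i) f) (shift (-i) g)
  simp only [translatedProj, LinearMap.comp_apply] at h ⊢
  rw [inner_shift_left, h, inner_shift_left, neg_neg]

theorem norm_translatedProj_le (hP₀ : IsStarProjection P₀) (i : Fin d → ℤ) (f : Hilb d N) :
    ‖translatedProj P₀ i f‖ ≤ ‖f‖ := by
  simp only [translatedProj, LinearMap.comp_apply]
  rw [norm_shift]
  refine (P₀.le_opNorm _).trans ?_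
  rw [norm_shift]
  exact mul_le_of_le_one_left (norm_nonneg f) hP₀.norm_le

end Lattice

/-! ### Compression to a box -/

section Compression

variable {d N : ℕ} (ℓ : ℕ)

/-- The inclusion of `ℓ²(Λ_ℓ) ⊗ ℂ^N` into `ℓ²(ℤ^d) ⊗ ℂ^N`. -/
noncomputable def boxInclusion : EuclideanSpace ℂ (box d ℓ × Fin N) →ₗ[ℂ] Hilb d N where
  toFun v := ∑ p : box d ℓ × Fin N,
    v p • lp.single 2 (p.1 : Fin d → ℤ) (EuclideanSpace.single p.2 (1 : ℂ))
  map_add' v w := by simp [add_smul, Finset.sum_add_distrib]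
  map_smul' c v := by simp [mul_smul, Finset.smul_sum]

theorem boxInclusion_apply (v : EuclideanSpace ℂ (box d ℓ × Fin N)) :
    boxInclusion ℓ v = ∑ p : box d ℓ × Fin N,
      v p • lp.single 2 (p.1 : Fin d → ℤ) (EuclideanSpace.single p.2 (1 : ℂ)) := rfl

theorem inner_boxInclusion_left (v : EuclideanSpace ℂ (box d ℓ × Fin N)) (f : Hilb d N) :
    ⟪boxInclusion ℓ v, f⟫_ℂ
      = ∑ p : box d ℓ × Fin N, starRingEnd ℂ (v p) * f (p.1 : Fin d → ℤ) p.2 := by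
  rw [boxInclusion_apply, sum_inner]
  refine Finset.sum_congr rfl fun p _ => ?_
  rw [inner_smul_left, lp.inner_single_left, EuclideanSpace.inner_single_left, map_one, one_mul]

theorem boxInclusion_apply_coe (v : EuclideanSpace ℂ (box d ℓ × Fin N)) (p : box d ℓ × Fin N) :
    boxInclusion ℓ v (p.1 : Fin d → ℤ) p.2 = v p := by
  rw [boxInclusion_apply, lp.coeFn_sum, Finset.sum_apply, WithLp.ofLp_sum, Finset.sum_apply,
    Finset.sum_eq_single p]
  · simp
  · rintro ⟨x, a⟩ - hne
    rw [lp.coeFn_smul, Pi.smul_apply, lp.single_apply, Pi.single_apply]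
    split_ifs with h
    · have hx : p.1 = x := Subtype.ext h
      have ha : p.2 ≠ a := fun ha => hne (Prod.ext hx.symm ha.symm)
      simp [ha]
    · simp
  · simp

theorem inner_boxInclusion_boxInclusion (v w : EuclideanSpace ℂ (box d ℓ × Fin N)) :
    ⟪boxInclusion ℓ v, boxInclusion ℓ w⟫_ℂ = ⟪v, w⟫_ℂ := by
  rw [inner_boxInclusion_left, PiLp.inner_apply]
  refine Finset.sum_congr rfl fun p _ => ?_
  rw [boxInclusion_apply_coe, RCLike.inner_apply, mul_comm]

theorem norm_boxInclusion (v : EuclideanSpace ℂ (box d ℓ × Fin N)) : ‖boxInclusion ℓ v‖ = ‖v‖ := by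
  rw [@norm_eq_sqrt_re_inner ℂ, inner_boxInclusion_boxInclusion, ← @norm_eq_sqrt_re_inner ℂ]

/-- The compression `χ_{Λ_ℓ} T χ_{Λ_ℓ}` of an operator, as an operator on `ℓ²(Λ_ℓ) ⊗ ℂ^N`. -/
noncomputable def compress (T : Hilb d N →ₗ[ℂ] Hilb d N) :
    EuclideanSpace ℂ (box d ℓ × Fin N) →L[ℂ] EuclideanSpace ℂ (box d ℓ × Fin N) :=
  LinearMap.toContinuousLinearMap
    { toFun := fun v => WithLp.toLp 2 fun p => T (boxInclusion ℓ v) (p.1 : Fin d → ℤ) p.2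
      map_add' := fun v w => by ext p; simp
      map_smul' := fun c v => by ext p; simp }

variable {ℓ}

theorem compress_apply (T : Hilb d N →ₗ[ℂ] Hilb d N) (v : EuclideanSpace ℂ (box d ℓ × Fin N))
    (p : box d ℓ × Fin N) :
    compress ℓ T v p = T (boxInclusion ℓ v) (p.1 : Fin d → ℤ) p.2 := rfl

theorem inner_compress_right (T : Hilb d N →ₗ[ℂ] Hilb d N)
    (v w : EuclideanSpace ℂ (box d ℓ × Fin N)) :
    ⟪v, compress ℓ T w⟫_ℂ = ⟪boxInclusion ℓ v, T (boxInclusion ℓ w)⟫_ℂ := by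
  rw [inner_boxInclusion_left, PiLp.inner_apply]
  refine Finset.sum_congr rfl fun p _ => ?_
  rw [compress_apply, RCLike.inner_apply, mul_comm]

theorem isSymmetric_compress {T : Hilb d N →ₗ[ℂ] Hilb d N}
    (hT : ∀ f g, ⟪T f, g⟫_ℂ = ⟪f, T g⟫_ℂ) : (compress ℓ T).IsSymmetric := by
  intro v w
  change ⟪compress ℓ T v, w⟫_ℂ = ⟪v, compress ℓ T w⟫_ℂ
  rw [← inner_conj_symm, inner_compress_right, inner_compress_right, inner_conj_symm, hT]

theorem norm_inner_compress_le {T : Hilb d N →ₗ[ℂ] Hilb d N} {c : ℝ} (hT : ∀ f, ‖T f‖ ≤ c * ‖f‖)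
    (v w : EuclideanSpace ℂ (box d ℓ × Fin N)) : ‖⟪v, compress ℓ T w⟫_ℂ‖ ≤ c * (‖v‖ * ‖w‖) := by
  rw [inner_compress_right]
  refine (norm_inner_le_norm _ _).trans ?_
  rw [norm_boxInclusion]
  refine (mul_le_mul_of_nonneg_left (hT _) (norm_nonneg v)).trans_eq ?_
  rw [norm_boxInclusion]
  ring

theorem norm_compress_le_one {T : Hilb d N →ₗ[ℂ] Hilb d N} (hT : ∀ f, ‖T f‖ ≤ ‖f‖) :
    ‖compress ℓ T‖ ≤ 1 := by
  refine ContinuousLinearMap.opNorm_le_bound _ zero_le_one fun w => ?_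
  have h := norm_inner_compress_le (c := 1) (fun f => by rw [one_mul]; exact hT f)
    (compress ℓ T w) w
  rw [inner_self_eq_norm_sq_to_K, norm_pow, RCLike.norm_ofReal, abs_norm, one_mul] at h
  rw [one_mul]
  by_contra! hlt
  have h0 : 0 < ‖compress ℓ T w‖ := (norm_nonneg w).trans_lt hlt
  nlinarith

end Compression

/-! ### The finite-volume Hamiltonian as an affine family -/

section Hamiltonian

variable {d N : ℕ} (𝓙 : AddSubgroup (Fin d → ℤ)) (X : Finset (Fin d → ℤ)) (ℓ : ℕ)

open scoped Classical in
/-- The indices of the coupling constants that can act in the box, when `P₀` is supported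
in `X`: the differences of a point of `X` and a point of the box that lie in `𝓙`. -/
noncomputable def activeSites : Finset 𝓙 :=
  ((X ×ˢ box d ℓ).image fun p => p.1 - p.2).subtype (· ∈ 𝓙)

theorem card_activeSites_le : (activeSites 𝓙 X ℓ).card ≤ X.card * (box d ℓ).card := by
  classical
  rw [activeSites, Finset.card_subtype, ← Finset.card_product]
  exact (Finset.card_filter_le _ _).trans Finset.card_image_le

theorem card_box : (box d ℓ).card = (2 * ℓ + 1) ^ d := by
  rw [box, Fintype.card_piFinset_const, Int.card_Icc]
  congr 1
  omega

variable {𝓙 X ℓ} {P₀ : Hilb d N →L[ℂ] Hilb d N}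

theorem translatedProj_boxInclusion_eq_zero (hX : ∀ x ∉ X, ∀ v, P₀ (lp.single 2 x v) = 0)
    {i : 𝓙} (hi : i ∉ activeSites 𝓙 X ℓ) (v : EuclideanSpace ℂ (box d ℓ × Fin N)) :
    translatedProj P₀ (i : Fin d → ℤ) (boxInclusion ℓ v) = 0 := by
  rw [boxInclusion_apply, map_sum]
  refine Finset.sum_eq_zero fun p _ => ?_
  classical
  -- translating back by `i` moves the unit vector at a point `q` of the box to `q + i`, outside `X`
  rw [map_smul, translatedProj, LinearMap.comp_apply, LinearMap.comp_apply, shift_single,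
    ContinuousLinearMap.coe_coe, hX, map_zero, smul_zero]
  intro hmem
  refine hi ?_
  rw [activeSites, Finset.mem_subtype]
  refine Finset.mem_image.2 ⟨((p.1 : Fin d → ℤ) - -i, p.1),
    Finset.mem_product.2 ⟨hmem, p.1.2⟩, ?_⟩
  simp

theorem sum_compress_translatedProj (hX : ∀ x ∉ X, ∀ v, P₀ (lp.single 2 x v) = 0)
    (hsum : ∀ f : Hilb d N, HasSum (fun i : 𝓙 => translatedProj P₀ (i : Fin d → ℤ) f) f) :
    ∑ i : activeSites 𝓙 X ℓ, compress ℓ (translatedProj P₀ ((i : 𝓙) : Fin d → ℤ)) = 1 := by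
  ext v p
  have h := (hsum (boxInclusion ℓ v)).unique
    (hasSum_sum_of_ne_finset_zero (s := activeSites 𝓙 X ℓ)
      fun i hi => translatedProj_boxInclusion_eq_zero hX hi v)
  rw [sum_apply, WithLp.ofLp_sum, Finset.sum_apply]
  simp only [compress_apply]
  rw [Finset.sum_coe_sort (activeSites 𝓙 X ℓ) fun i =>
    translatedProj P₀ (i : Fin d → ℤ) (boxInclusion ℓ v) (p.1 : Fin d → ℤ) p.2,
    ← Finset.sum_apply, ← WithLp.ofLp_sum, ← Finset.sum_apply, ← lp.coeFn_sum, ← h,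
    boxInclusion_apply_coe]
  rfl

theorem finiteVolume_mulVec (A : EuclideanSpace ℂ (Fin N) →L[ℂ] EuclideanSpace ℂ (Fin N))
    (hX : ∀ x ∉ X, ∀ v, P₀ (lp.single 2 x v) = 0) (ω : 𝓙 → ℝ)
    (v : EuclideanSpace ℂ (box d ℓ × Fin N)) :
    WithLp.toLp 2 (Matrix.mulVec (finiteVolume A 𝓙 P₀ ω ℓ) v)
      = (compress ℓ (laplacian d N ∘ₗ fiberwise A) + ∑ i : activeSites 𝓙 X ℓ,
          (ω i : ℂ) • compress ℓ (translatedProj P₀ ((i : 𝓙) : Fin d → ℤ))) v := by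
  let T : Hilb d N →ₗ[ℂ] Hilb d N := laplacian d N ∘ₗ fiberwise A +
    ∑ i : activeSites 𝓙 X ℓ, (ω i : ℂ) • translatedProj P₀ ((i : 𝓙) : Fin d → ℤ)
  have hT : ∀ q : box d ℓ × Fin N, hamiltonian A 𝓙 P₀ ω
      (lp.single 2 (q.1 : Fin d → ℤ) (EuclideanSpace.single q.2 (1 : ℂ)))
      = T (lp.single 2 (q.1 : Fin d → ℤ) (EuclideanSpace.single q.2 (1 : ℂ))) := by
    intro q
    have hq : lp.single 2 (q.1 : Fin d → ℤ) (EuclideanSpace.single q.2 (1 : ℂ))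
        = boxInclusion ℓ (EuclideanSpace.single q (1 : ℂ)) := by
      rw [boxInclusion_apply, Finset.sum_eq_single q] <;> simp +contextual
    rw [hamiltonian, tsum_eq_sum (s := activeSites 𝓙 X ℓ) fun i hi => by
      rw [hq, translatedProj_boxInclusion_eq_zero hX hi, smul_zero]]
    simp only [T, LinearMap.add_apply, LinearMap.sum_apply, LinearMap.smul_apply,
      LinearMap.comp_apply]
    rw [Finset.sum_coe_sort (activeSites 𝓙 X ℓ) fun i => (ω i : ℂ) •
      translatedProj P₀ (i : Fin d → ℤ)
        (lp.single 2 (q.1 : Fin d → ℤ) (EuclideanSpace.single q.2 (1 : ℂ)))]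
  ext p
  have h1 : (compress ℓ (laplacian d N ∘ₗ fiberwise A) + ∑ i : activeSites 𝓙 X ℓ,
      (ω i : ℂ) • compress ℓ (translatedProj P₀ ((i : 𝓙) : Fin d → ℤ))) v p
      = T (boxInclusion ℓ v) (p.1 : Fin d → ℤ) p.2 := by
    simp only [T, LinearMap.add_apply, LinearMap.sum_apply, LinearMap.smul_apply, lp.coeFn_add,
      Pi.add_apply, lp.coeFn_sum, Finset.sum_apply, lp.coeFn_smul, Pi.smul_apply]
    simp [-Complex.coe_smul, sum_apply, compress_apply]
  rw [h1, boxInclusion_apply, map_sum, lp.coeFn_sum, Finset.sum_apply, WithLp.ofLp_sum,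
    Finset.sum_apply]
  refine Finset.sum_congr rfl fun q _ => ?_
  rw [map_smul, ← hT, mul_comm]
  rfl

end Hamiltonian

/-! ### Spectral counts and eigenvectors -/

section Spectrum

theorem exists_mulVec_eq_of_one_le_spectralCount {n : Type*} [Fintype n] [DecidableEq n]
    {H : Matrix n n ℂ} {B : Set ℝ} (h : 1 ≤ spectralCount H B) :
    ∃ e ∈ B, ∃ v : n → ℂ, v ≠ 0 ∧ H.mulVec v = (e : ℂ) • v := by
  by_contra! hcon
  have hB : ∀ e ∈ spectrum ℝ H, e ∉ B := by
    intro e he heB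
    rw [spectrum.mem_iff, Matrix.isUnit_iff_isUnit_det, isUnit_iff_ne_zero, not_not,
      ← Matrix.exists_mulVec_eq_zero_iff] at he
    obtain ⟨v, hv, hv0⟩ := he
    refine hcon e heB v hv ?_
    rw [Matrix.sub_mulVec, sub_eq_zero, Algebra.algebraMap_eq_smul_one, Matrix.smul_mulVec,
      Matrix.one_mulVec] at hv0
    rw [← hv0, Complex.coe_smul]
  have hzero : spectralProjection H B = 0 := by
    rw [spectralProjection, cfc_congr (g := 0) fun e he => Set.indicator_of_notMem (hB e he) _]
    exact cfc_zero ℝ H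
  rw [spectralCount, hzero, Matrix.trace_zero, Complex.zero_re] at h
  linarith

end Spectrum

/-! ### The finite-volume estimate -/

section Assembly

theorem withDensity_closedBall_le {g : ℝ → ℝ} {M : ℝ} (hM : 0 ≤ M) (hg : ∀ x, g x ≤ M) (x ρ : ℝ) :
    volume.withDensity (fun x => ENNReal.ofReal (g x)) (Metric.closedBall x ρ)
      ≤ ENNReal.ofReal (2 * M * ρ) := by
  rw [withDensity_apply _ Metric.isClosed_closedBall.measurableSet]
  refine (lintegral_mono fun y => ENNReal.ofReal_le_ofReal (hg y)).trans_eq ?_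
  rw [lintegral_const, Measure.restrict_apply_univ, Real.volume_closedBall,
    ← ENNReal.ofReal_mul hM]
  congr 1
  ring

theorem exists_ae_abs_le_of_hasCompactSupport {g : ℝ → ℝ} (hg : Measurable g)
    (hg_supp : HasCompactSupport g) :
    ∃ R > 0, ∀ᵐ x ∂volume.withDensity (fun x => ENNReal.ofReal (g x)), |x| ≤ R := by
  obtain ⟨R, hR, hsub⟩ := hg_supp.isCompact.isBounded.subset_closedBall_lt 0 0
  refine ⟨R, hR, ?_⟩
  rw [ae_withDensity_iff hg.ennreal_ofReal]
  refine Filter.Eventually.of_forall fun x hx => ?_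
  have h : x ∈ tsupport g := subset_tsupport g fun h0 => hx (by rw [h0, ENNReal.ofReal_zero])
  simpa using hsub h

theorem scaledInterval_subset {I : Set ℝ} {r : ℝ} (hI : I ⊆ Metric.closedBall 0 r) (d L : ℕ)
    (E : ℝ) : scaledInterval d L I E
      ⊆ Set.Icc (E - r / (L : ℝ) ^ d) (E + r / (L : ℝ) ^ d) := by
  rintro _ ⟨t, ht, rfl⟩
  have h : |t| ≤ r := by simpa using hI ht
  obtain ⟨h1, h2⟩ := abs_le.1 h
  have h3 : t / (L : ℝ) ^ d ≤ r / (L : ℝ) ^ d := by gcongr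
  have h4 : -r / (L : ℝ) ^ d ≤ t / (L : ℝ) ^ d := by gcongr
  rw [neg_div] at h4
  constructor <;> linarith

variable {d N : ℕ} {A : EuclideanSpace ℂ (Fin N) →L[ℂ] EuclideanSpace ℂ (Fin N)}
  {𝓙 : AddSubgroup (Fin d → ℤ)} {P₀ : Hilb d N →L[ℂ] Hilb d N} {X : Finset (Fin d → ℤ)} {ℓ : ℕ}

theorem exists_hasEigenvalue_of_one_le_spectralCount (hX : ∀ x ∉ X, ∀ v, P₀ (lp.single 2 x v) = 0)
    {ω : 𝓙 → ℝ} {B : Set ℝ} (h : 1 ≤ spectralCount (finiteVolume A 𝓙 P₀ ω ℓ) B) :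
    ∃ e ∈ B, Module.End.HasEigenvalue
      (compress ℓ (laplacian d N ∘ₗ fiberwise A) + ∑ i : activeSites 𝓙 X ℓ,
        (ω i : ℂ) • compress ℓ (translatedProj P₀ ((i : 𝓙) : Fin d → ℤ))).toLinearMap (e : ℂ) := by
  obtain ⟨e, he, v, hv, hve⟩ := exists_mulVec_eq_of_one_le_spectralCount h
  refine ⟨e, he, Module.End.hasEigenvalue_of_hasEigenvector (x := WithLp.toLp 2 v)
    ⟨Module.End.mem_eigenspace_iff.2 ?_, ?_⟩⟩
  · rw [ContinuousLinearMap.coe_coe, ← finiteVolume_mulVec A hX ω, WithLp.ofLp_toLp, hve,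
      WithLp.toLp_smul]
  · exact fun h0 => hv (congrArg WithLp.ofLp h0)

/-- The bound `|Λ_ℓ|¹² η²` in terms of `L`; this is where `α ≤ (2 / 5) β` enters. -/
theorem rpow_pow_mul_div_sq_le {d : ℕ} {α β c r x : ℝ} (hx : 1 ≤ x) (hαβ : α ≤ 2 / 5 * β) :
    (c * (x ^ α) ^ d) ^ 12 * (r / x ^ d) ^ 2
      ≤ c ^ 12 * r ^ 2 / x ^ (2 * (d : ℝ) * (1 - 2 * β - α)) := by
  have hx0 : 0 < x := by linarith
  have h1 : ((x ^ α) ^ d) ^ 12 / (x ^ d) ^ 2 = x ^ (12 * α * d - 2 * d) := by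
    rw [Real.rpow_sub hx0, ← pow_mul, ← pow_mul, ← Real.rpow_natCast, ← Real.rpow_natCast x,
      ← Real.rpow_mul hx0.le]
    congr 2 <;> push_cast <;> ring
  have h2 : x ^ (12 * α * d - 2 * d) ≤ (x ^ (2 * (d : ℝ) * (1 - 2 * β - α)))⁻¹ := by
    rw [← Real.rpow_neg hx0.le]
    refine Real.rpow_le_rpow_of_exponent_le hx ?_
    have h3 : (d : ℝ) * (10 * α) ≤ d * (4 * β) :=
      mul_le_mul_of_nonneg_left (by linarith) (Nat.cast_nonneg d)
    linarith
  calc (c * (x ^ α) ^ d) ^ 12 * (r / x ^ d) ^ 2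
      = c ^ 12 * r ^ 2 * (((x ^ α) ^ d) ^ 12 / (x ^ d) ^ 2) := by
        rw [mul_pow, div_pow]
        ring
    _ ≤ c ^ 12 * r ^ 2 * (x ^ (2 * (d : ℝ) * (1 - 2 * β - α)))⁻¹ := by
        rw [h1]
        gcongr
    _ = _ := (div_eq_mul_inv _ _).symm

theorem norm_inner_compress_laplacian_le (hA : ‖A‖ ≤ 1)
    (v : EuclideanSpace ℂ (box d ℓ × Fin N)) :
    ‖⟪v, compress ℓ (laplacian d N ∘ₗ fiberwise A) v⟫_ℂ‖ ≤ 2 * d * ‖v‖ ^ 2 := by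
  have hT : ∀ f : Hilb d N, ‖(laplacian d N ∘ₗ fiberwise A) f‖ ≤ (2 * d : ℝ) * ‖f‖ := fun f => by
    rw [LinearMap.comp_apply]
    exact norm_laplacian_fiberwise_le hA f
  have h := norm_inner_compress_le (ℓ := ℓ) hT v v
  rwa [← sq] at h

/-- The finite-volume decorrelation estimate for windows of half-width `η`, with explicit
constants; `Y` bounds the dimension and the number of coupling constants. -/
theorem measure_one_le_spectralCount_pair_le (hA : IsSelfAdjoint A) (hAnorm : ‖A‖ ≤ 1)
    (hP₀ : IsStarProjection P₀) (hX : ∀ x ∉ X, ∀ v, P₀ (lp.single 2 x v) = 0)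
    (hsum : ∀ f : Hilb d N, HasSum (fun i : 𝓙 => translatedProj P₀ (i : Fin d → ℤ) f) f)
    {Ω : Type*} [MeasurableSpace Ω] {Pr : Measure Ω} {ω : 𝓙 → Ω → ℝ}
    (hmeas : ∀ i, Measurable (ω i)) (hindep : iIndepFun ω Pr) {μ : Measure ℝ}
    [IsProbabilityMeasure μ] (hlaw : ∀ i, Pr.map (ω i) = μ) {M R : ℝ} (hM : 0 ≤ M)
    (hμ : ∀ x ρ : ℝ, 0 ≤ ρ → μ (Metric.closedBall x ρ) ≤ ENNReal.ofReal (2 * M * ρ))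
    (hR : 0 < R) (hμR : ∀ᵐ x ∂μ, |x| ≤ R) {E E' η κ Y : ℝ} (hE : 4 * (d : ℝ) + κ ≤ |E - E'|)
    (hκ : 0 < κ) (hη : 0 < η) (hY : 1 ≤ Y) (hXY : (X.card : ℝ) * (box d ℓ).card ≤ Y)
    (hNY : (N : ℝ) * (box d ℓ).card ≤ Y) {B B' : Set ℝ} (hB : B ⊆ Set.Icc (E - η) (E + η))
    (hB' : B' ⊆ Set.Icc (E' - η) (E' + η)) :
    Pr {w | 1 ≤ spectralCount (finiteVolume A 𝓙 P₀ (fun i => ω i w) ℓ) B ∧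
        1 ≤ spectralCount (finiteVolume A 𝓙 P₀ (fun i => ω i w) ℓ) B'}
      ≤ ENNReal.ofReal ((16 + 400 * M ^ 2 * R ^ 2) / κ ^ 2 * Y ^ 12 * η ^ 2) := by
  have hF : (Fintype.card (activeSites 𝓙 X ℓ) : ℝ) ≤ Y := by
    rw [Fintype.card_coe]
    refine le_trans ?_ hXY
    exact_mod_cast card_activeSites_le 𝓙 X ℓ
  have hV : (Module.finrank ℂ (EuclideanSpace ℂ (box d ℓ × Fin N)) : ℝ) ≤ Y := by
    rwa [finrank_euclideanSpace, Fintype.card_prod, Fintype.card_coe, Fintype.card_fin,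
      Nat.cast_mul, mul_comm]
  have hmain := measure_hasEigenvalue_pair_le
    (K := compress ℓ (laplacian d N ∘ₗ fiberwise A))
    (Q := fun i : activeSites 𝓙 X ℓ => compress ℓ (translatedProj P₀ ((i : 𝓙) : Fin d → ℤ)))
    (isSymmetric_compress fun f f' => inner_laplacian_fiberwise_left hA f f')
    (fun i => isSymmetric_compress (inner_translatedProj_left hP₀ _))
    (fun i => norm_compress_le_one (norm_translatedProj_le hP₀ _))
    (sum_compress_translatedProj hX hsum) (k := 2 * d)
    (norm_inner_compress_laplacian_le hAnorm) μ hM hμ hR hμR (E := E) (E' := E') (by linarith)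
    hκ hη hY hF hV
  have hlawF : Pr.map (fun w (i : activeSites 𝓙 X ℓ) => ω i w)
      = Measure.pi fun _ : activeSites 𝓙 X ℓ => μ := by
    rw [(hindep.precomp Subtype.val_injective).map_fun_eq_pi_map
      fun i : activeSites 𝓙 X ℓ => (hmeas i).aemeasurable]
    simp only [hlaw]
  rw [← hlawF] at hmain
  refine le_trans ?_ hmain
  refine (measure_mono ?_).trans (Measure.le_map_apply
    (aemeasurable_pi_lambda _ fun i : activeSites 𝓙 X ℓ => (hmeas i).aemeasurable) _)
  rintro w ⟨h1, h2⟩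
  obtain ⟨e, he, hev⟩ := exists_hasEigenvalue_of_one_le_spectralCount hX h1
  obtain ⟨e', he', hev'⟩ := exists_hasEigenvalue_of_one_le_spectralCount hX h2
  exact ⟨⟨e, hB he, hev⟩, e', hB' he', hev'⟩

end Assembly

end GenAnderson

theorem proposition1p2 {d N m : ℕ} (hd : 1 ≤ d) (hm : 1 ≤ m)
    (A : EuclideanSpace ℂ (Fin N) →L[ℂ] EuclideanSpace ℂ (Fin N))
    (hA : IsSelfAdjoint A) (hAunit : IsUnit A) (hAnorm : ‖A‖ ≤ 1)
    (𝓙 : AddSubgroup (Fin d → ℤ))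
    (P₀ : GenAnderson.Hilb d N →L[ℂ] GenAnderson.Hilb d N)
    (hP₀ : IsStarProjection P₀)
    (hrank : Module.finrank ℂ P₀.range = m)
    (hlocal : {x : Fin d → ℤ | ∃ v : EuclideanSpace ℂ (Fin N), P₀ (lp.single 2 x v) ≠ 0}.Finite)
    (hsum : ∀ f : GenAnderson.Hilb d N,
      HasSum (fun i : 𝓙 => GenAnderson.translatedProj P₀ (i : Fin d → ℤ) f) f)
    {Ω : Type*} [MeasurableSpace Ω] (Pr : Measure Ω) [IsProbabilityMeasure Pr]
    (ω : 𝓙 → Ω → ℝ) (hmeas : ∀ i, Measurable (ω i)) (hindep : iIndepFun ω Pr)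
    (g : ℝ → ℝ) (hg_meas : Measurable g) (hg_nonneg : ∀ x, 0 ≤ g x)
    (hg_bdd : ∃ M : ℝ, ∀ x, g x ≤ M) (hg_supp : HasCompactSupport g)
    (hlaw : ∀ i, Pr.map (ω i) = volume.withDensity fun x => ENNReal.ofReal (g x))
    (α β : ℝ) (hβ0 : 0 < β) (hβ1 : β < 1 / 2) (hαβ0 : 0 < α + 4 * β) (hαβ1 : α + 4 * β < 1)
    (hα0 : 0 < α) (hα1 : α < 2 / 5 * β)
    (E E' : ℝ) (hE : 4 * (d : ℝ) < |E - E'|)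
    (I J : Set ℝ) (hI : I.OrdConnected) (hI' : Bornology.IsBounded I)
    (hJ : J.OrdConnected) (hJ' : Bornology.IsBounded J) :
    ∃ C₀ : ℝ, ∀ L : ℕ, 1 ≤ L →
      Pr.real {w |
          1 ≤ GenAnderson.spectralCount
            (GenAnderson.finiteVolume A 𝓙 P₀ (fun i => ω i w) ⌊(L : ℝ) ^ α⌋₊)
            (GenAnderson.scaledInterval d L I E) ∧
          1 ≤ GenAnderson.spectralCount
            (GenAnderson.finiteVolume A 𝓙 P₀ (fun i => ω i w) ⌊(L : ℝ) ^ α⌋₊)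
            (GenAnderson.scaledInterval d L J E')}
        ≤ C₀ / (L : ℝ) ^ (2 * (d : ℝ) * (1 - 2 * β - α)) := by
  have hX : ∀ x ∉ hlocal.toFinset, ∀ v, P₀ (lp.single 2 x v) = 0 := by
    intro x hx v
    by_contra hne
    exact hx (hlocal.mem_toFinset.2 ⟨v, hne⟩)
  obtain ⟨M₀, hM₀⟩ := hg_bdd
  obtain ⟨R, hR, hμR⟩ := GenAnderson.exists_ae_abs_le_of_hasCompactSupport hg_meas hg_supp
  have : IsProbabilityMeasure (volume.withDensity fun x => ENNReal.ofReal (g x)) := by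
    rw [← hlaw 0]
    exact Measure.isProbabilityMeasure_map (hmeas 0).aemeasurable
  obtain ⟨r, hr, hIJr⟩ := (hI'.union hJ').subset_closedBall_lt 0 0
  have hκ : 0 < |E - E'| - 4 * (d : ℝ) := sub_pos.2 hE
  generalize hlocal.toFinset = X at hX
  -- `b * |Λ_ℓ|` bounds both the dimension and the number of coupling constants in the box
  obtain ⟨b, hb1, hbX, hbN⟩ : ∃ b : ℝ, 1 ≤ b ∧ (X.card : ℝ) ≤ b ∧ (N : ℝ) ≤ b :=
    ⟨max 1 (max (X.card : ℝ) N), le_max_left _ _, (le_max_left _ _).trans (le_max_right _ _),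
      (le_max_right _ _).trans (le_max_right _ _)⟩
  refine ⟨(16 + 400 * max M₀ 0 ^ 2 * R ^ 2) / (|E - E'| - 4 * (d : ℝ)) ^ 2 *
    ((b * 3 ^ d) ^ 12 * r ^ 2), fun L hL => ?_⟩
  have hL1 : (1 : ℝ) ≤ L := by exact_mod_cast hL
  have hLα : (1 : ℝ) ≤ (L : ℝ) ^ α := Real.one_le_rpow hL1 hα0.le
  have hℓ : (⌊(L : ℝ) ^ α⌋₊ : ℝ) ≤ (L : ℝ) ^ α := Nat.floor_le (by linarith)
  generalize ⌊(L : ℝ) ^ α⌋₊ = ℓ at hℓ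
  have hbox : ((GenAnderson.box d ℓ).card : ℝ) ≤ 3 ^ d * ((L : ℝ) ^ α) ^ d := by
    rw [GenAnderson.card_box, ← mul_pow]
    push_cast
    gcongr
    linarith
  have hmain := GenAnderson.measure_one_le_spectralCount_pair_le (ℓ := ℓ) hA hAnorm hP₀ hX hsum
    hmeas hindep hlaw (le_max_right M₀ 0)
    (fun x ρ _ => GenAnderson.withDensity_closedBall_le (le_max_right M₀ 0)
      (fun x => (hM₀ x).trans (le_max_left _ _)) x ρ)
    hR hμR (E := E) (E' := E') (η := r / (L : ℝ) ^ d) (κ := |E - E'| - 4 * (d : ℝ))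
    (Y := b * 3 ^ d * ((L : ℝ) ^ α) ^ d) (by linarith) hκ (by positivity)
    (one_le_mul_of_one_le_of_one_le (one_le_mul_of_one_le_of_one_le hb1
      (one_le_pow₀ (by norm_num))) (one_le_pow₀ hLα))
    (by rw [mul_assoc]; gcongr) (by rw [mul_assoc]; gcongr)
    (GenAnderson.scaledInterval_subset (Set.subset_union_left.trans hIJr) d L E)
    (GenAnderson.scaledInterval_subset (Set.subset_union_right.trans hIJr) d L E')
  refine (ENNReal.toReal_le_of_le_ofReal (by positivity) hmain).trans ?_
  rw [mul_assoc, mul_div_assoc]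
  exact mul_le_mul_of_nonneg_left (GenAnderson.rpow_pow_mul_div_sq_le hL1 hα1.le) (by positivity)
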